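/- Let $A$ be a finite-dimensional algebra over a field, let $\mathscr{A}=A\text{-mod}$ be the category of finitely generated left $A$-modules, and let $\mathscr{C}$ be a full additive subcategory of $\mathscr{A}$ that is closed under direct summands and admissible, i.e. contravariantly finite (every $D\in\mathscr{A}$ has a right $\mathscr{C}$-approximation: a morphism $C\to D$ with $C\in\mathscr{C}$ through which every morphism $C'\to D$ with $C'\in\mathscr{C}$ factors) and such that every right $\mathscr{C}$-approximation is an epimorphism. A complex $X^\bullet$ in $\mathscr{A}$ is called $\mathscr{C}$-acyclic, or $\operatorname{Hom}_{\mathscr{A}}(\mathscr{C},-)$-exact, if $\operatorname{Hom}_{\mathscr{A}}(C,X^\bullet)$ is acyclic for all $C\in\mathscr{C}$, and $\operatorname{Hom}_{\mathscr{A}}(-,\mathscr{C})$-exact if $\operatorname{Hom}_{\mathscr{A}}(X^\bullet,C)$ is acyclic for all $C\in\mathscr{C}$. Let $\mathscr{G}(\mathscr{C})$ be the full subcategory of $\mathscr{A}$ of all $M$ isomorphic to $\operatorname{Im}(C^{-1}\to C^0)$ for some acyclic complex $C^\bullet$ with all terms in $\mathscr{C}$ that is both $\operatorname{Hom}_{\mathscr{A}}(\mathscr{C},-)$-exact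 and $\operatorname{Hom}_{\mathscr{A}}(-,\mathscr{C})$-exact. For $M\in\mathscr{A}$ let $\mathscr{C}\mathscr{G}(\mathscr{C})\text{-}\dim M\in\{0,1,2,\dots,\infty\}$ be the infimum of all $n\ge 0$ for which there is a $\operatorname{Hom}_{\mathscr{A}}(\mathscr{C},-)$-exact complex $0\to G^{-n}\to\cdots\to G^0\to M\to 0$ with all $G^i\in\mathscr{G}(\mathscr{C})$, and put $\mathscr{C}\mathscr{G}(\mathscr{C})\text{-}\dim\mathscr{A}=\sup_{M\in\mathscr{A}}\mathscr{C}\mathscr{G}(\mathscr{C})\text{-}\dim M$. Let $D^b_{\mathscr{C}}(\mathscr{A})=K^b(\mathscr{A})/K^b_{\mathscr{C}\text{-}ac}(\mathscr{A})$ be the Verdier quotient of the bounded homotopy category of $\mathscr{A}$ by its full subcategory of $\mathscr{C}$-acyclic complexes, and let $D_{\mathscr{C}\text{-}sg}(\mathscr{A})=D^b_{\mathscr{C}}(\mathscr{A})/K^b(\mathscr{C})$ be the $\mathscr{C}$-singularity category, the Verdier quotient by the bounded homotopy category of $\mathscr{C}$ viewed as a full subcategory of $D^b_{\mathscr{C}}(\mathscr{A})$.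 Let $\theta:\mathscr{G}(\mathscr{C})\to D_{\mathscr{C}\text{-}sg}(\mathscr{A})$ be the composition of the inclusion $\mathscr{G}(\mathscr{C})\hookrightarrow\mathscr{A}$, the functor $\mathscr{A}\to K^b(\mathscr{A})\to D^b_{\mathscr{C}}(\mathscr{A})$ that regards an object as a complex concentrated in degree $0$, and the quotient functor $D^b_{\mathscr{C}}(\mathscr{A})\to D_{\mathscr{C}\text{-}sg}(\mathscr{A})$. If $\mathscr{C}\mathscr{G}(\mathscr{C})\text{-}\dim\mathscr{A}<\infty$, then $\theta$ is essentially surjective: every object of $D_{\mathscr{C}\text{-}sg}(\mathscr{A})$ is isomorphic to $\theta(X')$ for some $X'\in\mathscr{G}(\mathscr{C})$. -/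

import Mathlib

open CategoryTheory CategoryTheory.Limits CategoryTheory.Pretriangulated Opposite

universe v u

noncomputable section

namespace RelSing

/-! ### Relative exactness, approximations, dimensions, the Gorenstein category -/

section Basic

variable {𝒜 : Type u} [Category.{v} 𝒜]

/-- A right `𝒞`-approximation of `D`: a morphism `f : C ⟶ D` with `C` in `𝒞` through which
every morphism to `D` from an object of `𝒞` factors. -/
def IsRightApprox (𝒞 : ObjectProperty 𝒜) {C D : 𝒜} (f : C ⟶ D) : Prop :=
  𝒞 C ∧ ∀ ⦃C' : 𝒜⦄, 𝒞 C' → ∀ g : C' ⟶ D, ∃ h : C' ⟶ C, h ≫ f = g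

/-- `𝒞` is contravariantly finite in `𝒜`. -/
def IsContravariantlyFinite (𝒞 : ObjectProperty 𝒜) : Prop :=
  ∀ D : 𝒜, ∃ (C : 𝒜) (f : C ⟶ D), IsRightApprox 𝒞 f

/-- `𝒞` is admissible: it is contravariantly finite and all right `𝒞`-approximations are epic. -/
def IsAdmissible (𝒞 : ObjectProperty 𝒜) : Prop :=
  IsContravariantlyFinite 𝒞 ∧ ∀ ⦃C D : 𝒜⦄ (f : C ⟶ D), IsRightApprox 𝒞 f → Epi f

variable [Abelian 𝒜]

/-- The complex `X` is `Hom(𝒞, -)`-exact (that is, `𝒞`-acyclic): the complex of abelian groups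
`Hom(C, X)` is acyclic for every `C` in `𝒞`. -/
def IsHomExact (𝒞 : ObjectProperty 𝒜) (X : CochainComplex 𝒜 ℤ) : Prop :=
  ∀ C : 𝒜, 𝒞 C →
    (((preadditiveCoyoneda.obj (op C)).mapHomologicalComplex (ComplexShape.up ℤ)).obj X).Acyclic

/-- The complex `X` is `Hom(-, 𝒞)`-exact: the complex of abelian groups
`Hom(X, C)` is acyclic for every `C` in `𝒞`. -/
def IsCohomExact (𝒞 : ObjectProperty 𝒜) (X : CochainComplex 𝒜 ℤ) : Prop :=
  ∀ C : 𝒜, 𝒞 C →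
    (((preadditiveYoneda.obj C).mapHomologicalComplex (ComplexShape.up ℤ).symm).obj X.op).Acyclic

/-- There is a `Hom(𝒞, -)`-exact complex `0 ⟶ D⁻ⁿ ⟶ ⋯ ⟶ D⁰ ⟶ M ⟶ 0` with all `Dⁱ` in `𝒟`.
The object `M` is put in degree `1`. -/
def HasProperResolution (𝒞 𝒟 : ObjectProperty 𝒜) (M : 𝒜) (n : ℕ) : Prop :=
  ∃ E : CochainComplex 𝒜 ℤ,
    (∀ i : ℤ, i < -(n : ℤ) → IsZero (E.X i)) ∧
    (∀ i : ℤ, -(n : ℤ) ≤ i → i ≤ 0 → 𝒟 (E.X i)) ∧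
    Nonempty (E.X 1 ≅ M) ∧
    (∀ i : ℤ, 1 < i → IsZero (E.X i)) ∧
    IsHomExact 𝒞 E

/-- The `𝒞`-proper `𝒟`-dimension of an object `M`. -/
def properDim (𝒞 𝒟 : ObjectProperty 𝒜) (M : 𝒜) : ℕ∞ :=
  ⨅ (n : ℕ) (_ : HasProperResolution 𝒞 𝒟 M n), (n : ℕ∞)

/-- The `𝒞`-proper `𝒟`-dimension of a class `ℰ` of objects. -/
def properDimOf (𝒞 𝒟 ℰ : ObjectProperty 𝒜) : ℕ∞ :=
  ⨆ (M : 𝒜) (_ : ℰ M), properDim 𝒞 𝒟 M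

end Basic

variable {𝒜 : Type u} [Category.{v} 𝒜] [Abelian 𝒜]

/-- The Gorenstein category `𝒢(𝒞)`: the objects isomorphic to `Im(C⁻¹ ⟶ C⁰)` for an acyclic
complex with terms in `𝒞` which is both `Hom(𝒞, -)`-exact and `Hom(-, 𝒞)`-exact. -/
def gorenstein (𝒞 : ObjectProperty 𝒜) : ObjectProperty 𝒜 := fun M =>
  ∃ X : CochainComplex 𝒜 ℤ, (∀ i : ℤ, 𝒞 (X.X i)) ∧ X.Acyclic ∧
    IsHomExact 𝒞 X ∧ IsCohomExact 𝒞 X ∧ Nonempty (M ≅ image (X.d (-1) 0))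

/-! ### The bounded homotopy category -/

/-- The bounded complexes, as a property of objects of the homotopy category. -/
def bounded (𝒜 : Type u) [Category.{v} 𝒜] [Abelian 𝒜] :
    ObjectProperty (HomotopyCategory 𝒜 (ComplexShape.up ℤ)) := fun X =>
  ∃ a b : ℤ, CochainComplex.IsStrictlyGE X.as a ∧ CochainComplex.IsStrictlyLE X.as b

lemma bounded_quotient_obj_iff (K : CochainComplex 𝒜 ℤ) :
    bounded 𝒜 ((HomotopyCategory.quotient 𝒜 (ComplexShape.up ℤ)).obj K) ↔
      ∃ a b : ℤ, K.IsStrictlyGE a ∧ K.IsStrictlyLE b := Iff.rfl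

lemma isStrictlyLE_mappingCone {K L : CochainComplex 𝒜 ℤ} (f : K ⟶ L)
    (n₁ n₂ n : ℤ) [K.IsStrictlyLE n₁] [L.IsStrictlyLE n₂] (hn₁ : n₁ ≤ n) (hn₂ : n₂ ≤ n) :
    (CochainComplex.mappingCone f).IsStrictlyLE n := by
  rw [CochainComplex.isStrictlyLE_iff]
  intro i hi
  simp only [CochainComplex.mappingCone.isZero_X_iff]
  exact ⟨K.isZero_of_isStrictlyLE n₁ _ (by lia), L.isZero_of_isStrictlyLE n₂ _ (by lia)⟩

open scoped ZeroObject in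
instance : (bounded 𝒜).ContainsZero where
  exists_zero :=
    ⟨(HomotopyCategory.quotient _ _).obj 0, Functor.map_isZero _ (isZero_zero _), by
      rw [bounded_quotient_obj_iff]
      exact ⟨0, 0, inferInstance, inferInstance⟩⟩

instance : (bounded 𝒜).IsStableUnderShift ℤ where
  isStableUnderShiftBy n :=
    { le_shift K hK := by
        obtain ⟨K : CochainComplex _ _, rfl⟩ := K.quotient_obj_surjective
        rw [bounded_quotient_obj_iff] at hK
        obtain ⟨a, b, _, _⟩ := hK
        rw [ObjectProperty.prop_shift_iff, HomotopyCategory.shift_quotient_obj,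
          bounded_quotient_obj_iff]
        exact ⟨a - n, b - n, K.isStrictlyGE_shift a n (a - n) (by lia),
          K.isStrictlyLE_shift b n (b - n) (by lia)⟩ }

instance : (bounded 𝒜).IsTriangulatedClosed₃ where
  ext₃' T hT h₁ h₂ := by
    obtain ⟨a₁, b₁, _, _⟩ := h₁
    obtain ⟨a₂, b₂, _, _⟩ := h₂
    obtain ⟨f : T.obj₁.as ⟶ T.obj₂.as, hf⟩ :=
      (HomotopyCategory.quotient _ _).map_surjective T.mor₁
    refine ⟨(HomotopyCategory.quotient _ _).obj (CochainComplex.mappingCone f), ?_,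
      ⟨Triangle.π₃.mapIso (isoTriangleOfIso₁₂ T _ hT
        (HomotopyCategory.mappingCone_triangleh_distinguished f)
        (Iso.refl _) (Iso.refl _) ?_)⟩⟩
    · rw [bounded_quotient_obj_iff]
      exact ⟨min (a₁ - 1) a₂, max b₁ b₂,
        CochainComplex.isStrictlyGE_mappingCone f a₁ a₂ _ (by simp) (by simp),
        isStrictlyLE_mappingCone f b₁ b₂ _ (by simp) (by simp)⟩
    · exact (Category.comp_id _).trans (hf.symm.trans (Category.id_comp _).symm)

instance : (bounded 𝒜).IsTriangulated where
  toIsTriangulatedClosed₂ := .of_isTriangulatedClosed₃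

/-- The bounded homotopy category `Kᵇ(𝒜)`. -/
abbrev Kb (𝒜 : Type u) [Category.{v} 𝒜] [Abelian 𝒜] := (bounded 𝒜).FullSubcategory

/-- The functor `𝒜 ⥤ Kᵇ(𝒜)` which sends an object to the complex concentrated in degree `0`. -/
def singleKb (𝒜 : Type u) [Category.{v} 𝒜] [Abelian 𝒜] : 𝒜 ⥤ Kb 𝒜 :=
  (bounded 𝒜).lift (CochainComplex.singleFunctor 𝒜 0 ⋙ HomotopyCategory.quotient 𝒜 _)
    (fun M => (bounded_quotient_obj_iff _).2
      ⟨0, 0, inferInstanceAs (((CochainComplex.singleFunctor 𝒜 0).obj M).IsStrictlyGE 0),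
        inferInstanceAs (((CochainComplex.singleFunctor 𝒜 0).obj M).IsStrictlyLE 0)⟩)

/-! ### The bounded relative derived category -/

/-- The `𝒞`-acyclic complexes, as a property of objects of the homotopy category. -/
def acyclicK (𝒞 : ObjectProperty 𝒜) :
    ObjectProperty (HomotopyCategory 𝒜 (ComplexShape.up ℤ)) := fun X => IsHomExact 𝒞 X.as

lemma acyclicK_iff (𝒞 : ObjectProperty 𝒜) (X : HomotopyCategory 𝒜 (ComplexShape.up ℤ)) :
    acyclicK 𝒞 X ↔ ∀ C : 𝒜, 𝒞 C →
      (HomotopyCategory.subcategoryAcyclic AddCommGrpCat.{v}).inverseImage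
        ((preadditiveCoyoneda.obj (op C)).mapHomotopyCategory (ComplexShape.up ℤ)) X :=
  forall₂_congr fun _ _ =>
    (HomotopyCategory.quotient_obj_mem_subcategoryAcyclic_iff_acyclic _).symm

instance (𝒞 : ObjectProperty 𝒜) : (acyclicK 𝒞).IsClosedUnderIsomorphisms where
  of_iso e h := by
    rw [acyclicK_iff] at h ⊢
    exact fun C hC => ObjectProperty.prop_of_iso _ e (h C hC)

open scoped ZeroObject in
instance (𝒞 : ObjectProperty 𝒜) : (acyclicK 𝒞).ContainsZero where
  exists_zero := ⟨0, isZero_zero _, by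
    rw [acyclicK_iff]
    exact fun C _ => ObjectProperty.prop_of_isZero _ (isZero_zero _)⟩

instance (𝒞 : ObjectProperty 𝒜) : (acyclicK 𝒞).IsStableUnderShift ℤ where
  isStableUnderShiftBy n :=
    { le_shift X hX := by
        rw [acyclicK_iff] at hX
        rw [ObjectProperty.prop_shift_iff, acyclicK_iff]
        exact fun C hC => ObjectProperty.le_shift _ n _ (hX C hC) }

instance (𝒞 : ObjectProperty 𝒜) : (acyclicK 𝒞).IsTriangulated where
  toIsTriangulatedClosed₂ := .mk' (fun T hT h₁ h₃ => by
    rw [acyclicK_iff] at h₁ h₃ ⊢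
    exact fun C hC => ObjectProperty.ext_of_isTriangulatedClosed₂ _ T hT (h₁ C hC) (h₃ C hC))

/-- The bounded `𝒞`-acyclic complexes `Kᵇ_{𝒞-ac}(𝒜)`, as a triangulated subcategory of
`Kᵇ(𝒜)`. -/
abbrev acyclicKb (𝒞 : ObjectProperty 𝒜) : ObjectProperty (Kb 𝒜) :=
  (acyclicK 𝒞).inverseImage (bounded 𝒜).ι

/-- The bounded `𝒞`-derived category, the Verdier quotient `Kᵇ(𝒜) / Kᵇ_{𝒞-ac}(𝒜)`. -/
abbrev Db (𝒞 : ObjectProperty 𝒜) := (acyclicKb 𝒞).trW.Localization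

/-- The quotient functor `Kᵇ(𝒜) ⥤ Dᵇ_𝒞(𝒜)`. -/
abbrev Qb (𝒞 : ObjectProperty 𝒜) : Kb 𝒜 ⥤ Db 𝒞 := (acyclicKb 𝒞).trW.Q

/-! ### The relative singularity category -/

/-- The bounded complexes with all terms in `𝒞`, as objects of `Kᵇ(𝒜)`. -/
def termsIn (𝒞 : ObjectProperty 𝒜) : ObjectProperty (Kb 𝒜) := fun X =>
  ∀ i : ℤ, 𝒞 (X.obj.as.X i)

/-- `Kᵇ(𝒞)` viewed as a full subcategory of `Dᵇ_𝒞(𝒜)`: the objects isomorphic to the image of a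
bounded complex with terms in `𝒞`. -/
def kbIn (𝒞 : ObjectProperty 𝒜) : ObjectProperty (Db 𝒞) := (termsIn 𝒞).map (Qb 𝒞)

/-- The `𝒞`-singularity category, the Verdier quotient `Dᵇ_𝒞(𝒜) / Kᵇ(𝒞)`: the morphisms whose
cone lies in `Kᵇ(𝒞)` are inverted. -/
abbrev Dsg (𝒞 : ObjectProperty 𝒜) := (kbIn 𝒞).trW.Localization

/-- The quotient functor `Dᵇ_𝒞(𝒜) ⥤ D_{𝒞-sg}(𝒜)`. -/
abbrev Qsg (𝒞 : ObjectProperty 𝒜) : Db 𝒞 ⥤ Dsg 𝒞 := (kbIn 𝒞).trW.Q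

/-- The natural functor `θ : 𝒢(𝒞) ⥤ D_{𝒞-sg}(𝒜)`, the composition
`𝒢(𝒞) ⥤ 𝒜 ⥤ Kᵇ(𝒜) ⥤ Dᵇ_𝒞(𝒜) ⥤ D_{𝒞-sg}(𝒜)`. -/
def theta (𝒞 : ObjectProperty 𝒜) : (gorenstein 𝒞).FullSubcategory ⥤ Dsg 𝒞 :=
  (gorenstein 𝒞).ι ⋙ singleKb 𝒜 ⋙ Qb 𝒞 ⋙ Qsg 𝒞

end RelSing

end

noncomputable section

namespace RelSing

variable {𝒜 : Type u} [Category.{v} 𝒜] [Abelian 𝒜]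

open CochainComplex

/-! ### Elementwise descriptions of exactness -/

/-! Every object of the singularity category comes from a bounded complex, and two moves cost
nothing there: passing along a chain map with `𝒞`-acyclic cone, and gluing on, by a cone or cocone,
a complex with terms in `𝒞`. These moves squeeze a bounded complex down to one Gorenstein object in
degree 0.

From above: a right `𝒞`-approximation of the top term, glued on one degree lower, makes the last
differential surjective on `Hom(C, -)` for `C` in `𝒞`, so the top degree can be truncated away
(`exists_sgIso_isStrictlyLE_sub_one`). Iteration leaves an object `M` in a single degree `-c ≤ 0`.
The dimension hypothesis then replaces `M` by a finite proper resolution by Gorenstein objects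
(`exists_sgIso_of_hasProperResolution`).

From below: the lowest term `G` embeds in an object `C` of `𝒞`. Gluing `C` on in the next degree
turns the lowest differential into the monomorphism from `G` to `X^{a+1} ⊕ C`. Its cokernel is a
pushout, again Gorenstein, because the cone of a chain map of complete resolutions is a complete
resolution (`gorenstein.exists_embedding`). Dividing out `G` removes the lowest degree
(`exists_sgIso_isStrictlyGE_add_one`), and repetition ends with a Gorenstein object in degree 0. -/

lemma isHomExact_iff (𝒞 : ObjectProperty 𝒜) (X : CochainComplex 𝒜 ℤ) :
    IsHomExact 𝒞 X ↔ ∀ ⦃C : 𝒜⦄, 𝒞 C → ∀ (i j k : ℤ), i + 1 = j → j + 1 = k →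
      ∀ φ : C ⟶ X.X j, φ ≫ X.d j k = 0 → ∃ ψ : C ⟶ X.X i, ψ ≫ X.d i j = φ := by
  refine forall₂_congr fun C hC => ⟨fun h i j k hij hjk φ hφ => ?_, fun h j => ?_⟩
  · have := h j
    rw [HomologicalComplex.exactAt_iff' _ i j k (by simp [← hij]) (by simp [hjk]),
      ShortComplex.ab_exact_iff] at this
    exact this φ hφ
  · rw [HomologicalComplex.exactAt_iff' _ (j - 1) j (j + 1) (by simp) (by simp),
      ShortComplex.ab_exact_iff]
    exact fun φ hφ => h (j - 1) j (j + 1) (by simp) rfl φ hφ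

lemma isCohomExact_iff (𝒞 : ObjectProperty 𝒜) (X : CochainComplex 𝒜 ℤ) :
    IsCohomExact 𝒞 X ↔ ∀ ⦃C : 𝒜⦄, 𝒞 C → ∀ (i j k : ℤ), i + 1 = j → j + 1 = k →
      ∀ φ : X.X j ⟶ C, X.d i j ≫ φ = 0 → ∃ ψ : X.X k ⟶ C, X.d j k ≫ ψ = φ := by
  refine forall₂_congr fun C hC => ⟨fun h i j k hij hjk φ hφ => ?_, fun h j => ?_⟩
  · have := h j
    rw [HomologicalComplex.exactAt_iff' _ k j i (ComplexShape.prev_eq' _ hjk)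
      (ComplexShape.next_eq' _ hij),
      ShortComplex.ab_exact_iff] at this
    exact this φ hφ
  · rw [HomologicalComplex.exactAt_iff' _ (j + 1) j (j - 1)
      (ComplexShape.prev_eq' _ (show j + 1 = j + 1 from rfl))
      (ComplexShape.next_eq' _ (show j - 1 + 1 = j by simp)),
      ShortComplex.ab_exact_iff]
    exact fun φ hφ => h (j - 1) j (j + 1) (by simp) rfl φ hφ

/-- A criterion for the mapping cone of a degreewise monomorphism to be `𝒞`-acyclic. -/
lemma isHomExact_mappingCone_of_mono (𝒞 : ObjectProperty 𝒜) {K L : CochainComplex 𝒜 ℤ}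
    (f : K ⟶ L) [∀ i, Mono (f.f i)]
    (hf : ∀ ⦃C : 𝒜⦄, 𝒞 C → ∀ (i j k : ℤ), i + 1 = j → j + 1 = k →
      ∀ (y : C ⟶ L.X j) (x : C ⟶ K.X k), y ≫ L.d j k = x ≫ f.f k →
        ∃ (t : C ⟶ K.X j) (z : C ⟶ L.X i), y = t ≫ f.f j + z ≫ L.d i j) :
    IsHomExact 𝒞 (mappingCone f) := by
  -- `hf` says that the quotient of `Hom(C, L)` by `Hom(C, K)` is acyclic. A cocycle `(x, y)` of the
  -- cone satisfies `x ≫ f = -(y ≫ d)`, so `x` is determined by `y`, as `f` is degreewise mono.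
  rw [isHomExact_iff]
  intro C hC i j k hij hjk φ hφ
  obtain ⟨x, y, rfl⟩ := mappingCone.decomp_to f φ k hjk
  have h1 := hφ =≫ (mappingCone.snd f).v k k (add_zero k)
  simp only [Preadditive.add_comp, Category.assoc, mappingCone.d_snd_v f j k hjk,
    Preadditive.comp_add, mappingCone.inl_v_fst_v_assoc, mappingCone.inr_f_fst_v_assoc,
    mappingCone.inl_v_snd_v_assoc, mappingCone.inr_f_snd_v_assoc, zero_comp,
    add_zero, zero_add] at h1
  obtain ⟨t, z, rfl⟩ := hf hC i j k hij hjk y (-x) (by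
    rw [Preadditive.neg_comp]; exact eq_neg_of_add_eq_zero_right h1)
  have h2 : x = - t ≫ K.d j k := by
    rw [← cancel_mono (f.f k)]
    simp only [Preadditive.add_comp, Category.assoc, HomologicalComplex.d_comp_d, comp_zero,
      add_zero, f.comm, Preadditive.neg_comp] at h1 ⊢
    exact eq_neg_of_add_eq_zero_left h1
  refine ⟨t ≫ (mappingCone.inl f).v j i (by lia) + z ≫ (mappingCone.inr f).f i, ?_⟩
  subst h2
  simp only [Preadditive.add_comp, Category.assoc, mappingCone.inl_v_d f j i k (by lia) (by lia),
    mappingCone.inr_f_d, Preadditive.comp_sub, Preadditive.neg_comp]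
  abel

/-- A criterion for the mapping cone of a degreewise `𝒞`-epimorphism to be `𝒞`-acyclic. -/
lemma isHomExact_mappingCone_of_surjective (𝒞 : ObjectProperty 𝒜) {K L : CochainComplex 𝒜 ℤ}
    (f : K ⟶ L)
    (hs : ∀ ⦃C : 𝒜⦄, 𝒞 C → ∀ (i : ℤ) (y : C ⟶ L.X i), ∃ t : C ⟶ K.X i, t ≫ f.f i = y)
    (hf : ∀ ⦃C : 𝒜⦄, 𝒞 C → ∀ (i j k : ℤ), i + 1 = j → j + 1 = k →
      ∀ (x : C ⟶ K.X j), x ≫ K.d j k = 0 → x ≫ f.f j = 0 →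
        ∃ z : C ⟶ K.X i, z ≫ K.d i j = x ∧ z ≫ f.f i = 0) :
    IsHomExact 𝒞 (mappingCone f) := by
  rw [isHomExact_iff]
  intro C hC i j k hij hjk φ hφ
  obtain ⟨x, y, rfl⟩ := mappingCone.decomp_to f φ k hjk
  have h1 := hφ =≫ (mappingCone.snd f).v k k (add_zero k)
  have h2 := hφ =≫ (mappingCone.fst f).1.v k (k + 1) rfl
  -- Writing `y` as `t ≫ f` and subtracting the boundary of `t` moves the cocycle into the kernel of
  -- `f`, where `hf` applies.
  obtain ⟨t, rfl⟩ := hs hC j y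
  simp only [Preadditive.add_comp, Category.assoc, mappingCone.d_snd_v f j k hjk,
    Preadditive.comp_add, mappingCone.inl_v_fst_v_assoc, mappingCone.inr_f_fst_v_assoc,
    mappingCone.inl_v_snd_v_assoc, mappingCone.inr_f_snd_v_assoc, zero_comp,
    add_zero, zero_add] at h1
  simp only [Preadditive.add_comp, Category.assoc, mappingCone.d_fst_v f j k _ hjk rfl,
    Preadditive.comp_neg, mappingCone.inl_v_fst_v_assoc, mappingCone.inr_f_fst_v_assoc,
    zero_comp, comp_zero, neg_zero, add_zero, neg_eq_zero] at h2
  obtain ⟨z, hz, hz'⟩ := hf hC j k (k + 1) hjk rfl (x + t ≫ K.d j k) (by simp [h2]) (by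
    rw [Preadditive.add_comp, Category.assoc, ← f.comm]; exact h1)
  obtain rfl : x = z ≫ K.d j k - t ≫ K.d j k := by rw [hz]; abel
  refine ⟨(t - z) ≫ (mappingCone.inl f).v j i (by lia), ?_⟩
  simp only [Category.assoc, mappingCone.inl_v_d f j i k (by lia) (by lia),
    Preadditive.comp_sub, Preadditive.sub_comp, reassoc_of% hz', zero_comp]
  abel

/-! ### Isomorphisms in the relative singularity category -/

/-- A bounded cochain complex. -/
def IsBoundedComplex (K : CochainComplex 𝒜 ℤ) : Prop :=
  ∃ a b : ℤ, K.IsStrictlyGE a ∧ K.IsStrictlyLE b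

lemma IsBoundedComplex.mk (K : CochainComplex 𝒜 ℤ) (a b : ℤ) [K.IsStrictlyGE a]
    [K.IsStrictlyLE b] : IsBoundedComplex K := ⟨a, b, inferInstance, inferInstance⟩

/-- The object of `Kᵇ(𝒜)` given by a bounded complex. -/
def toKb (K : CochainComplex 𝒜 ℤ) (hK : IsBoundedComplex K) : Kb 𝒜 :=
  ⟨(HomotopyCategory.quotient 𝒜 (ComplexShape.up ℤ)).obj K, hK⟩

/-- The morphism of `Kᵇ(𝒜)` given by a morphism of bounded complexes. -/
def toKbMap {K L : CochainComplex 𝒜 ℤ} (hK : IsBoundedComplex K) (hL : IsBoundedComplex L)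
    (f : K ⟶ L) : toKb K hK ⟶ toKb L hL :=
  ObjectProperty.homMk ((HomotopyCategory.quotient 𝒜 (ComplexShape.up ℤ)).map f)

lemma isBoundedComplex_mappingCone {K L : CochainComplex 𝒜 ℤ} (hK : IsBoundedComplex K)
    (hL : IsBoundedComplex L) (f : K ⟶ L) : IsBoundedComplex (mappingCone f) := by
  obtain ⟨a₁, b₁, _, _⟩ := hK
  obtain ⟨a₂, b₂, _, _⟩ := hL
  exact ⟨min (a₁ - 1) a₂, max b₁ b₂,
    isStrictlyGE_mappingCone f a₁ a₂ _ (by simp) (by simp),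
    isStrictlyLE_mappingCone f b₁ b₂ _ (by simp) (by simp)⟩

lemma IsBoundedComplex.shift {K : CochainComplex 𝒜 ℤ} (hK : IsBoundedComplex K) (n : ℤ) :
    IsBoundedComplex (K⟦n⟧) := by
  obtain ⟨a, b, _, _⟩ := hK
  exact ⟨a - n, b - n, K.isStrictlyGE_shift a n (a - n) (by lia),
    K.isStrictlyLE_shift b n (b - n) (by lia)⟩

lemma isBoundedComplex_mappingCocone {K L : CochainComplex 𝒜 ℤ} (hK : IsBoundedComplex K)
    (hL : IsBoundedComplex L) (f : K ⟶ L) : IsBoundedComplex (mappingCocone f) :=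
  (isBoundedComplex_mappingCone hK hL f).shift (-1)

/-- Distinguished triangles of `Kb 𝒜` are detected in the homotopy category; the third map lifts by
fullness, after correction by the shift isomorphism of the inclusion. -/
lemma exists_distTriang_homMk (T : Triangle (HomotopyCategory 𝒜 (ComplexShape.up ℤ)))
    (hT : T ∈ distTriang _) (h₁ : bounded 𝒜 T.obj₁) (h₂ : bounded 𝒜 T.obj₂)
    (h₃ : bounded 𝒜 T.obj₃) :
    ∃ h : (⟨T.obj₃, h₃⟩ : Kb 𝒜) ⟶ (⟨T.obj₁, h₁⟩ : Kb 𝒜)⟦(1 : ℤ)⟧,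
      Triangle.mk (ObjectProperty.homMk T.mor₁ : (⟨T.obj₁, h₁⟩ : Kb 𝒜) ⟶ ⟨T.obj₂, h₂⟩)
        (ObjectProperty.homMk T.mor₂) h ∈ distTriang (Kb 𝒜) :=
  ⟨(bounded 𝒜).fullyFaithfulι.preimage
      (T.mor₃ ≫ ((bounded 𝒜).ι.commShiftIso (1 : ℤ)).inv.app ⟨T.obj₁, h₁⟩),
    isomorphic_distinguished _ hT _
      (Triangle.isoMk _ _ (Iso.refl _) (Iso.refl _) (Iso.refl _)
        ((Category.comp_id _).trans (Category.id_comp _).symm)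
        ((Category.comp_id _).trans (Category.id_comp _).symm) (by
          change ((T.mor₃ ≫ ((bounded 𝒜).ι.commShiftIso (1 : ℤ)).inv.app ⟨T.obj₁, h₁⟩) ≫
            ((bounded 𝒜).ι.commShiftIso (1 : ℤ)).hom.app ⟨T.obj₁, h₁⟩) ≫ (𝟙 T.obj₁)⟦(1 : ℤ)⟧' =
              𝟙 _ ≫ T.mor₃
          simp))⟩

/-- A morphism of bounded complexes fits in a distinguished triangle of `Kᵇ(𝒜)` whose third
object is the mapping cone. -/
lemma exists_distTriang_mappingCone {K L : CochainComplex 𝒜 ℤ} (hK : IsBoundedComplex K)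
    (hL : IsBoundedComplex L) (f : K ⟶ L) :
    ∃ (h : toKb (mappingCone f) (isBoundedComplex_mappingCone hK hL f) ⟶ (toKb K hK)⟦(1 : ℤ)⟧),
      Triangle.mk (toKbMap hK hL f) (toKbMap hL _ (mappingCone.inr f)) h ∈ distTriang (Kb 𝒜) :=
  exists_distTriang_homMk _ (HomotopyCategory.mappingCone_triangleh_distinguished f) hK hL
    (isBoundedComplex_mappingCone hK hL f)

/-- A morphism of bounded complexes fits in a distinguished triangle of `Kᵇ(𝒜)` whose first
object is the mapping cocone. -/
lemma exists_distTriang_mappingCocone {K L : CochainComplex 𝒜 ℤ} (hK : IsBoundedComplex K)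
    (hL : IsBoundedComplex L) (f : K ⟶ L) :
    ∃ (h : toKb L hL ⟶ (toKb (mappingCocone f) (isBoundedComplex_mappingCocone hK hL f))⟦(1 : ℤ)⟧),
      Triangle.mk (toKbMap _ hK (mappingCocone.fst f)) (toKbMap hK hL f) h ∈
        distTriang (Kb 𝒜) := by
  refine exists_distTriang_homMk ((HomotopyCategory.quotient 𝒜 _).mapTriangle.obj
    (mappingCocone.triangle f)) ?_ (isBoundedComplex_mappingCocone hK hL f) hK hL
  rw [Pretriangulated.rotate_distinguished_triangle]
  exact isomorphic_distinguished _ (HomotopyCategory.mappingCone_triangleh_distinguished f) _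
    ((HomotopyCategory.quotient 𝒜 _).mapTriangleRotateIso.app _ ≪≫
    (HomotopyCategory.quotient 𝒜 _).mapTriangle.mapIso (mappingCocone.rotateTriangleIso f))

/-- Two bounded complexes which become isomorphic in the relative singularity category. -/
def SgIso (𝒞 : ObjectProperty 𝒜) (K L : CochainComplex 𝒜 ℤ) : Prop :=
  ∃ (hK : IsBoundedComplex K) (hL : IsBoundedComplex L),
    Nonempty ((Qsg 𝒞).obj ((Qb 𝒞).obj (toKb K hK)) ≅ (Qsg 𝒞).obj ((Qb 𝒞).obj (toKb L hL)))

lemma SgIso.symm {𝒞 : ObjectProperty 𝒜} {K L : CochainComplex 𝒜 ℤ} (h : SgIso 𝒞 K L) :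
    SgIso 𝒞 L K := by
  obtain ⟨hK, hL, ⟨e⟩⟩ := h
  exact ⟨hL, hK, ⟨e.symm⟩⟩

lemma SgIso.trans {𝒞 : ObjectProperty 𝒜} {K L M : CochainComplex 𝒜 ℤ} (h : SgIso 𝒞 K L)
    (h' : SgIso 𝒞 L M) : SgIso 𝒞 K M := by
  obtain ⟨hK, hL, ⟨e⟩⟩ := h
  obtain ⟨_, hM, ⟨e'⟩⟩ := h'
  exact ⟨hK, hM, ⟨e ≪≫ e'⟩⟩

lemma SgIso.of_iso (𝒞 : ObjectProperty 𝒜) {K L : CochainComplex 𝒜 ℤ} (hK : IsBoundedComplex K)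
    (e : K ≅ L) : SgIso 𝒞 K L := by
  have hL : IsBoundedComplex L := by
    obtain ⟨a, b, _, _⟩ := hK
    exact ⟨a, b, isStrictlyGE_of_iso e a, isStrictlyLE_of_iso e b⟩
  refine ⟨hK, hL, ⟨(Qsg 𝒞).mapIso ((Qb 𝒞).mapIso ?_)⟩⟩
  exact (bounded 𝒜).isoMk ((HomotopyCategory.quotient 𝒜 (ComplexShape.up ℤ)).mapIso e)

/-- A morphism of bounded complexes with `𝒞`-acyclic cone becomes an isomorphism. -/
lemma SgIso.of_isHomExact (𝒞 : ObjectProperty 𝒜) {K L : CochainComplex 𝒜 ℤ}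
    (hK : IsBoundedComplex K) (hL : IsBoundedComplex L) (f : K ⟶ L)
    (hf : IsHomExact 𝒞 (mappingCone f)) : SgIso 𝒞 K L := by
  obtain ⟨_, hT⟩ := exists_distTriang_mappingCone hK hL f
  have : IsIso ((Qb 𝒞).map (toKbMap hK hL f)) :=
    (acyclicKb 𝒞).trW.Q_inverts _ ((acyclicKb 𝒞).trW_iff _ |>.2 ⟨_, _, _, hT, hf⟩)
  exact ⟨hK, hL, ⟨(Qsg 𝒞).mapIso (asIso ((Qb 𝒞).map (toKbMap hK hL f)))⟩⟩

/-- The cone lies in `kbIn 𝒞`. The auxiliary `Z` is there because rotation yields the shift of an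
object of `Kb 𝒜`, which is only isomorphic to the shifted complex whose terms are visibly in `𝒞`. -/
lemma isIso_of_termsIn_obj₃ (𝒞 : ObjectProperty 𝒜) (T : Triangle (Kb 𝒜))
    (hT : T ∈ distTriang (Kb 𝒜)) {Z : Kb 𝒜} (e : T.obj₃ ≅ Z) (h : termsIn 𝒞 Z) :
    IsIso ((Qsg 𝒞).map ((Qb 𝒞).map T.mor₁)) := by
  refine (kbIn 𝒞).trW.Q_inverts _ ?_
  exact ((kbIn 𝒞).trW_iff _).2 ⟨_, _, _, (Qb 𝒞).map_distinguished T hT,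
    ((termsIn 𝒞).map (Qb 𝒞)).prop_of_iso ((Qb 𝒞).mapIso e.symm)
      (ObjectProperty.prop_map_obj _ _ h)⟩

/-- The inclusion of complexes in `Kᵇ(𝒜)` commutes with shifts. -/
def toKbShiftIso {K : CochainComplex 𝒜 ℤ} (hK : IsBoundedComplex K) (n : ℤ) :
    (toKb K hK)⟦n⟧ ≅ toKb (K⟦n⟧) (hK.shift n) :=
  (bounded 𝒜).fullyFaithfulι.preimageIso
    (((bounded 𝒜).ι.commShiftIso n).app (toKb K hK) ≪≫
      (((HomotopyCategory.quotient 𝒜 (ComplexShape.up ℤ)).commShiftIso n).app K).symm)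

/-- The inclusion in the mapping cone of a morphism from a complex with terms in `𝒞` becomes an
isomorphism. -/
lemma SgIso.inr_of_terms (𝒞 : ObjectProperty 𝒜) {K L : CochainComplex 𝒜 ℤ}
    (hK : IsBoundedComplex K) (hL : IsBoundedComplex L) (f : K ⟶ L) (h : ∀ i, 𝒞 (K.X i)) :
    SgIso 𝒞 L (mappingCone f) := by
  obtain ⟨_, hT⟩ := exists_distTriang_mappingCone hK hL f
  have := isIso_of_termsIn_obj₃ 𝒞 _ (rot_of_distTriang _ hT) (toKbShiftIso hK 1)
    (fun i => h (i + 1))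
  exact ⟨hL, isBoundedComplex_mappingCone hK hL f, ⟨@asIso _ _ _ _ _ this⟩⟩

/-- The projection from the mapping cocone of a morphism to a complex with terms in `𝒞` becomes
an isomorphism. -/
lemma SgIso.fst_of_terms (𝒞 : ObjectProperty 𝒜) {K L : CochainComplex 𝒜 ℤ}
    (hK : IsBoundedComplex K) (hL : IsBoundedComplex L) (f : K ⟶ L) (h : ∀ i, 𝒞 (L.X i)) :
    SgIso 𝒞 (mappingCocone f) K := by
  obtain ⟨_, hT⟩ := exists_distTriang_mappingCocone hK hL f
  have := isIso_of_termsIn_obj₃ 𝒞 _ hT (Iso.refl _) h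
  exact ⟨isBoundedComplex_mappingCocone hK hL f, hK, ⟨@asIso _ _ _ _ _ this⟩⟩

/-! ### Components of the canonical truncation morphisms -/

lemma isIso_πTruncGE_f (K : CochainComplex 𝒜 ℤ) (n i : ℤ) (hi : n < i) :
    IsIso ((K.πTruncGE n).f i) := by
  obtain ⟨j, hj⟩ := Int.le.dest hi.le
  have := K.isIso_restrictionToTruncGE' (ComplexShape.embeddingUpIntGE n) j (by
    rw [ComplexShape.boundaryGE_embeddingUpIntGE_iff]; lia)
  dsimp only [CochainComplex.πTruncGE, HomologicalComplex.πTruncGE]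
  rw [ComplexShape.Embedding.liftExtend_f _ _ _ (i := j) hj]
  exact IsIso.comp_isIso' inferInstance (IsIso.comp_isIso' this (Iso.isIso_inv _))

lemma πTruncGE_f_self (K : CochainComplex 𝒜 ℤ) (n : ℤ) :
    (K.πTruncGE n).f n = K.pOpcycles n ≫ (K.truncGEXIsoOpcycles n).inv := by
  have hj : (ComplexShape.embeddingUpIntGE n).f 0 = n := by simp
  dsimp only [CochainComplex.πTruncGE, HomologicalComplex.πTruncGE,
    CochainComplex.truncGEXIsoOpcycles, HomologicalComplex.truncGEXIsoOpcycles]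
  rw [ComplexShape.Embedding.liftExtend_f _ _ _ (i := 0) hj,
    K.restrictionToTruncGE'_f_eq_iso_hom_pOpcycles_iso_inv _ hj
      (by rw [ComplexShape.boundaryGE_embeddingUpIntGE_iff])]
  simp
  rfl

lemma isIso_ιTruncLE_f (K : CochainComplex 𝒜 ℤ) (n i : ℤ) (hi : i < n) :
    IsIso ((K.ιTruncLE n).f i) := by
  obtain ⟨j, hj⟩ := Int.le.dest hi.le
  have hj' : (ComplexShape.embeddingUpIntLE n).f j = i := by
    change n - (j : ℤ) = i; lia
  have := K.op.isIso_restrictionToTruncGE' (ComplexShape.embeddingUpIntLE n).op j (by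
    rw [ComplexShape.Embedding.op_boundaryGE_iff,
      ComplexShape.boundaryLE_embeddingUpIntLE_iff]; lia)
  have : IsIso ((K.op.πTruncGE (ComplexShape.embeddingUpIntLE n).op).f i) := by
    rw [show (K.op.πTruncGE (ComplexShape.embeddingUpIntLE n).op).f i = _ from
      ComplexShape.Embedding.liftExtend_f (ComplexShape.embeddingUpIntLE n).op _
        (K.op.restrictionToTruncGE'_hasLift _) (i := j) hj']
    exact IsIso.comp_isIso' inferInstance (IsIso.comp_isIso' this (Iso.isIso_inv _))
  exact inferInstanceAs (IsIso ((K.op.πTruncGE (ComplexShape.embeddingUpIntLE n).op).f i).unop)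

instance (K : CochainComplex 𝒜 ℤ) (n i : ℤ) : Mono ((K.ιTruncLE n).f i) :=
  inferInstanceAs (Mono ((HomologicalComplex.ιTruncLE K (ComplexShape.embeddingUpIntLE n)).f i))

/-- A cocycle `T ⟶ K.X n` is a chain map from the stalk complex of `T` in degree `n`. That complex
equals its own truncation, so naturality gives the lift. -/
lemma exists_comp_ιTruncLE_f (K : CochainComplex 𝒜 ℤ) (n : ℤ) {T : 𝒜} (y : T ⟶ K.X n)
    (hy : y ≫ K.d n (n + 1) = 0) : ∃ t, t ≫ (K.ιTruncLE n).f n = y := by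
  let S : CochainComplex 𝒜 ℤ := (HomologicalComplex.single 𝒜 (ComplexShape.up ℤ) n).obj T
  let φ : S ⟶ K :=
    HomologicalComplex.mkHomFromSingle y (by rintro k rfl; exact hy)
  refine ⟨(HomologicalComplex.singleObjXSelf _ n T).inv ≫
    (inv (S.ιTruncLE n) ≫ truncLEMap φ n).f n, ?_⟩
  have h : (inv (S.ιTruncLE n) ≫ truncLEMap φ n) ≫ K.ιTruncLE n = φ := by
    rw [Category.assoc, ιTruncLE_naturality, IsIso.inv_hom_id_assoc]
  have hφ : φ.f n = (HomologicalComplex.singleObjXSelf _ n T).hom ≫ y :=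
    HomologicalComplex.mkHomFromSingle_f _ _
  rw [Category.assoc, ← HomologicalComplex.comp_f, h, hφ, Iso.inv_hom_id_assoc]

/-! ### Shortening a complex at the top -/

instance (𝒞 : ObjectProperty 𝒜) [𝒞.IsClosedUnderFiniteProducts] : 𝒞.ContainsZero where
  exists_zero :=
    ⟨_, (isZero_zero 𝒜).of_iso (terminalIsTerminal.uniqueUpToIso HasZeroObject.zeroIsTerminal),
      𝒞.prop_of_isLimit (limit.isLimit (Functor.empty.{0} 𝒜)) (by simp)⟩

lemma prop_single_X (𝒞 : ObjectProperty 𝒜) [𝒞.IsClosedUnderFiniteProducts]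
    [𝒞.IsClosedUnderIsomorphisms] {C : 𝒜} (hC : 𝒞 C) (n i : ℤ) :
    𝒞 (((HomologicalComplex.single 𝒜 (ComplexShape.up ℤ) n).obj C).X i) := by
  by_cases h : i = n
  · subst h
    exact 𝒞.prop_of_iso (HomologicalComplex.singleObjXSelf _ i C).symm hC
  · exact 𝒞.prop_of_isZero (HomologicalComplex.isZero_single_obj_X _ _ _ _ h)

/-- A complex in degrees `[a, b]` is isomorphic in the singularity category to a complex in
degrees `[a, b - 1]`. -/
lemma exists_sgIso_isStrictlyLE_sub_one (𝒞 : ObjectProperty 𝒜) [𝒞.IsClosedUnderFiniteProducts]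
    [𝒞.IsClosedUnderIsomorphisms] (hC : IsContravariantlyFinite 𝒞) (X : CochainComplex 𝒜 ℤ)
    (a b : ℤ) (hab : a ≤ b) [X.IsStrictlyGE a] [X.IsStrictlyLE (b + 1)] :
    ∃ Y : CochainComplex 𝒜 ℤ, Y.IsStrictlyGE a ∧ Y.IsStrictlyLE b ∧ SgIso 𝒞 X Y := by
  obtain ⟨C, ε, hC, hε⟩ := hC (X.X (b + 1))
  let S : CochainComplex 𝒜 ℤ := (HomologicalComplex.single 𝒜 (ComplexShape.up ℤ) (b + 1)).obj C
  let f : S ⟶ X := HomologicalComplex.mkHomFromSingle ε (fun k (hk : b + 1 + 1 = k) =>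
    (X.isZero_of_isStrictlyLE (b + 1) k (by lia)).eq_of_tgt _ _)
  have hS : IsBoundedComplex S := .mk S (b + 1) (b + 1)
  have hX : IsBoundedComplex X := .mk X a (b + 1)
  -- The cone puts `C` in degree `b`: its terms there are `X^b ⊕ C` and then `X^{b+1}`. Since `a ≤
  -- b`, the lower bound `a` survives.
  let W := mappingCone f
  have : W.IsStrictlyGE a := isStrictlyGE_mappingCone f (b + 1) a a (by lia) (by lia)
  have : W.IsStrictlyLE (b + 1) := isStrictlyLE_mappingCone f (b + 1) (b + 1) _ le_rfl le_rfl
  have hT : IsBoundedComplex (W.truncLE b) := .mk _ a b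
  refine ⟨W.truncLE b, inferInstance, inferInstance,
    (SgIso.inr_of_terms 𝒞 hS hX f (prop_single_X 𝒞 hC _)).trans
    (SgIso.of_isHomExact 𝒞 hT (.mk W a (b + 1)) (W.ιTruncLE b) ?_).symm⟩
  apply isHomExact_mappingCone_of_mono
  intro C' hC' i j k hij hjk y x hyx
  obtain hj | hj := lt_or_ge j b
  · have := isIso_ιTruncLE_f W b j hj
    exact ⟨y ≫ inv ((W.ιTruncLE b).f j), 0, by simp⟩
  replace hyx : y ≫ W.d j k = 0 := by
    rw [hyx, ((W.truncLE b).isZero_of_isStrictlyLE b k (by lia)).eq_of_tgt x 0, zero_comp]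
  obtain rfl | hj := hj.eq_or_lt
  · subst hjk
    obtain ⟨t, ht⟩ := exists_comp_ιTruncLE_f W b y hyx
    exact ⟨t, 0, by simp [ht]⟩
  obtain rfl | hj := (show b + 1 ≤ j from hj).eq_or_lt
  -- This is the degree removed by truncation: the approximation property lifts the given map
  -- through `ε` into the summand `C` of `W.X b`.
  · obtain rfl : i = b := by lia
    obtain ⟨x, y, rfl⟩ := mappingCone.decomp_to f y k hjk
    obtain ⟨h, rfl⟩ := hε hC' y
    obtain rfl : x = 0 := (S.isZero_of_isStrictlyLE (i + 1) k (by lia)).eq_of_tgt _ _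
    refine ⟨0, (h ≫ (HomologicalComplex.singleObjXSelf _ (i + 1) C).inv) ≫
      (mappingCone.inl f).v (i + 1) i (by lia), ?_⟩
    have hf : f.f (i + 1) = (HomologicalComplex.singleObjXSelf _ (i + 1) C).hom ≫ ε :=
      HomologicalComplex.mkHomFromSingle_f _ _
    have hd : S.d (i + 1) k = 0 := HomologicalComplex.single_obj_d _ _ _ _ _
    simp [W, mappingCone.inl_v_d f (i + 1) i k (by lia) (by lia), hf, hd]
  · exact ⟨0, 0, (W.isZero_of_isStrictlyLE (b + 1) j hj).eq_of_tgt _ _⟩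

/-- A bounded complex is isomorphic in the singularity category to a complex
concentrated in its lowest degree. -/
lemma exists_sgIso_concentrated (𝒞 : ObjectProperty 𝒜) [𝒞.IsClosedUnderFiniteProducts]
    [𝒞.IsClosedUnderIsomorphisms] (hC : IsContravariantlyFinite 𝒞) (X : CochainComplex 𝒜 ℤ)
    (a : ℤ) (n : ℕ) [X.IsStrictlyGE a] [X.IsStrictlyLE (a + n)] :
    ∃ Y : CochainComplex 𝒜 ℤ, Y.IsStrictlyGE a ∧ Y.IsStrictlyLE a ∧ SgIso 𝒞 X Y := by
  induction n generalizing X with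
  | zero =>
    have : X.IsStrictlyLE a := X.isStrictlyLE_of_le (a + (0 : ℕ)) a (by simp)
    exact ⟨X, inferInstance, inferInstance, .of_iso 𝒞 (.mk X a a) (Iso.refl X)⟩
  | succ n ih =>
    have : X.IsStrictlyLE (a + n + 1) := X.isStrictlyLE_of_le (a + (n + 1 : ℕ)) _ (by lia)
    obtain ⟨Y, _, _, hY⟩ := exists_sgIso_isStrictlyLE_sub_one 𝒞 hC X a (a + n) (by lia)
    obtain ⟨Z, h₁, h₂, hZ⟩ := ih Y
    exact ⟨Z, h₁, h₂, hY.trans hZ⟩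

/-! ### Replacing an object by a proper resolution -/

lemma IsHomExact.shift {𝒞 : ObjectProperty 𝒜} {X : CochainComplex 𝒜 ℤ} (hX : IsHomExact 𝒞 X)
    (n : ℤ) : IsHomExact 𝒞 (X⟦n⟧) := by
  have h : acyclicK 𝒞 (((HomotopyCategory.quotient 𝒜 (ComplexShape.up ℤ)).obj X)⟦n⟧) :=
    (acyclicK 𝒞).le_shift n _ hX
  rwa [HomotopyCategory.shift_quotient_obj] at h

lemma stupidTrunc_d_comp_stupidTruncXIso_hom {ι ι' : Type*} {c : ComplexShape ι}
    {c' : ComplexShape ι'} (K : HomologicalComplex 𝒜 c') (e : c.Embedding c') [e.IsRelIff]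
    {i j : ι} {i' j' : ι'} (hi : e.f i = i') (hj : e.f j = j') :
    (K.stupidTrunc e).d i' j' ≫ (K.stupidTruncXIso e hj).hom =
      (K.stupidTruncXIso e hi).hom ≫ K.d i' j' := by
  subst hi hj
  change ((K.restriction e).extend e).d _ _ ≫ ((K.restriction e).extendXIso e rfl).hom ≫
    𝟙 ((K.restriction e).X j) = (((K.restriction e).extendXIso e rfl).hom ≫
      𝟙 ((K.restriction e).X i)) ≫ (K.restriction e).d i j
  rw [HomologicalComplex.extend_d_eq _ _ rfl rfl]
  simp only [Category.assoc, Category.comp_id, Iso.inv_hom_id]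

/-- An object with a proper resolution, put in degree `a`, is isomorphic in the singularity
category to the complex given by the resolution. -/
lemma exists_sgIso_of_hasProperResolution (𝒞 𝒟 : ObjectProperty 𝒜) [𝒟.ContainsZero]
    [𝒟.IsClosedUnderIsomorphisms] {M : 𝒜} {n : ℕ} (h : HasProperResolution 𝒞 𝒟 M n) (a : ℤ) :
    ∃ R : CochainComplex 𝒜 ℤ, R.IsStrictlyGE (a - n) ∧ R.IsStrictlyLE a ∧ (∀ i, 𝒟 (R.X i)) ∧
      SgIso 𝒞 R ((HomologicalComplex.single 𝒜 (ComplexShape.up ℤ) a).obj M) := by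
  obtain ⟨E, hE₁, hE₂, ⟨μ⟩, hE₃, hE⟩ := h
  -- `E` carries `M` in degree 1, so this shift puts `M` in degree `a + 1` and the last term of the
  -- resolution in degree `a`. The differential `F.d a (a + 1)` becomes the augmentation `φ`.
  let F : CochainComplex 𝒜 ℤ := E⟦-a⟧
  have hF := (isHomExact_iff 𝒞 F).1 (hE.shift (-a))
  let μ' : F.X (a + 1) ≅ M := E.XIsoOfEq (by lia) ≪≫ μ
  let e := ComplexShape.embeddingUpIntLE a
  let R : CochainComplex 𝒜 ℤ := F.stupidTrunc e
  have he (i : ℤ) (hi : i ≤ a) : e.f (a - i).toNat = i := by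
    change a - ((a - i).toNat : ℤ) = i; lia
  let ρ (i : ℤ) (hi : i ≤ a) : R.X i ≅ F.X i := F.stupidTruncXIso e (he i hi)
  have hρ (i j : ℤ) (hi : i ≤ a) (hj : j ≤ a) : R.d i j ≫ (ρ j hj).hom = (ρ i hi).hom ≫ F.d i j :=
    stupidTrunc_d_comp_stupidTruncXIso_hom F e (he i hi) (he j hj)
  have hRLE : R.IsStrictlyLE a := inferInstance
  have hRGE : R.IsStrictlyGE (a - n) := by
    rw [isStrictlyGE_iff]
    intro i hi
    exact (hE₁ (i + -a) (by lia)).of_iso (ρ i (by lia))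
  let S : CochainComplex 𝒜 ℤ := (HomologicalComplex.single 𝒜 (ComplexShape.up ℤ) a).obj M
  let φ : R ⟶ S := HomologicalComplex.mkHomToSingle
    ((ρ a le_rfl).hom ≫ F.d a (a + 1) ≫ μ'.hom) (fun i (hi : i + 1 = a) => by
      rw [reassoc_of% (hρ i a (by lia) le_rfl), HomologicalComplex.d_comp_d_assoc, zero_comp,
        comp_zero])
  have hφ : φ.f a = ((ρ a le_rfl).hom ≫ F.d a (a + 1) ≫ μ'.hom) ≫
      (HomologicalComplex.singleObjXSelf _ a M).inv := HomologicalComplex.mkHomToSingle_f _ _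
  have hS (i : ℤ) (hi : i ≠ a) : IsZero (S.X i) := HomologicalComplex.isZero_single_obj_X _ _ _ _ hi
  refine ⟨R, hRGE, hRLE, fun i => ?_, SgIso.of_isHomExact 𝒞 (.mk R (a - n) a) (.mk S a a) φ
    (isHomExact_mappingCone_of_surjective 𝒞 φ ?_ ?_)⟩
  · by_cases hi : a - n ≤ i ∧ i ≤ a
    · exact 𝒟.prop_of_iso (ρ i hi.2).symm (hE₂ (i + -a) (by lia) (by lia))
    · refine 𝒟.prop_of_isZero ?_
      obtain hi | hi : i < a - n ∨ a < i := by lia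
      · exact R.isZero_of_isStrictlyGE (a - n) i hi
      · exact R.isZero_of_isStrictlyLE a i hi
  · intro C hC i y
    by_cases hi : i = a
    · subst hi
      obtain ⟨t, ht⟩ := hF hC i (i + 1) (i + 1 + 1) rfl rfl
        (y ≫ (HomologicalComplex.singleObjXSelf _ i M).hom ≫ μ'.inv)
        ((hE₃ _ (by lia)).eq_of_tgt _ _)
      refine ⟨t ≫ (ρ i le_rfl).inv, ?_⟩
      rw [hφ]
      simp only [Category.assoc, Iso.inv_hom_id_assoc, reassoc_of% ht]
      simp
    · exact ⟨0, (hS i hi).eq_of_tgt _ _⟩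
  · intro C hC i j k hij hjk x hx hx'
    obtain hj | hj := lt_or_ge a j
    · exact ⟨0, (R.isZero_of_isStrictlyLE a j hj).eq_of_tgt _ _, by simp⟩
    · have hxF : (x ≫ (ρ j hj).hom) ≫ F.d j k = 0 := by
        obtain rfl | hj := hj.eq_or_lt
        · subst hjk
          rw [hφ] at hx'
          simpa only [← Category.assoc, Preadditive.IsIso.comp_right_eq_zero] using hx'
        · rw [Category.assoc, ← hρ j k (by lia) (by lia), reassoc_of% hx, zero_comp]
      obtain ⟨z, hz⟩ := hF hC i j k hij hjk _ hxF
      refine ⟨z ≫ (ρ i (by lia)).inv, ?_, (hS i (by lia)).eq_of_tgt _ _⟩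
      rw [← cancel_mono (ρ j hj).hom, ← hz, Category.assoc, Category.assoc, hρ i j (by lia) hj,
        Iso.inv_hom_id_assoc]

/-! ### Morphisms of complete resolutions -/

/-- Dependent choice in both directions along the integers. -/
lemma exists_int_section {T : ℤ → Type*} (R : ∀ i, T i → T (i + 1) → Prop)
    (up : ∀ i t, ∃ t', R i t t') (down : ∀ i t', ∃ t, R i t t') (t₀ : T 0) :
    ∃ s : ∀ i, T i, s 0 = t₀ ∧ ∀ i, R i (s i) (s (i + 1)) := by
  choose p hp using up
  choose q hq using down
  let s : ∀ i, T i := fun i => match i with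
    | Int.ofNat n => Nat.rec (motive := fun n => T (Int.ofNat n)) t₀ (fun n t => p (Int.ofNat n) t) n
    | Int.negSucc n => Nat.rec (motive := fun n => T (Int.negSucc n)) (q (Int.negSucc 0) t₀)
        (fun n t => q (Int.negSucc (n + 1)) t) n
  refine ⟨s, rfl, fun i => ?_⟩
  match i with
  | Int.ofNat n => exact hp (Int.ofNat n) _
  | Int.negSucc 0 => exact hq (Int.negSucc 0) t₀
  | Int.negSucc (n + 1) => exact hq (Int.negSucc (n + 1)) _

/-- A morphism in degree `0` between complexes with terms in `𝒞` extends to a morphism of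
complexes. -/
lemma exists_hom_f_zero_eq {𝒞 : ObjectProperty 𝒜} {X Y : CochainComplex 𝒜 ℤ}
    (hX : ∀ i, 𝒞 (X.X i)) (hY : ∀ i, 𝒞 (Y.X i)) (hX' : IsCohomExact 𝒞 X) (hY' : IsHomExact 𝒞 Y)
    (φ : X.X 0 ⟶ Y.X 0) (hφ : X.d (-1) 0 ≫ φ ≫ Y.d 0 1 = 0) :
    ∃ F : X ⟶ Y, F.f 0 = φ := by
  rw [isCohomExact_iff] at hX'
  rw [isHomExact_iff] at hY'
  -- A state at `i` is a commuting square, and neighbouring squares must share a component. Going up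
  -- uses `Hom(-, 𝒞)`-exactness of `X`; going down uses `Hom(𝒞, -)`-exactness of `Y`.
  let T (i : ℤ) := { p : (X.X i ⟶ Y.X i) × (X.X (i + 1) ⟶ Y.X (i + 1)) //
    p.1 ≫ Y.d i (i + 1) = X.d i (i + 1) ≫ p.2 }
  obtain ⟨φ₁, hφ₁⟩ := hX' (hY 1) (-1) 0 1 rfl rfl (φ ≫ Y.d 0 1) hφ
  obtain ⟨s, hs₀, hs⟩ := exists_int_section (T := T) (fun i t t' => t.1.2 = t'.1.1)
    (fun i t => by
      obtain ⟨⟨a, b⟩, hab⟩ := t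
      dsimp only at hab
      obtain ⟨c, hc⟩ := hX' (hY (i + 1 + 1)) i (i + 1) (i + 1 + 1) rfl rfl (b ≫ Y.d _ _) (by
        rw [← reassoc_of% hab, HomologicalComplex.d_comp_d, comp_zero])
      exact ⟨⟨⟨b, c⟩, hc.symm⟩, rfl⟩)
    (fun i t => by
      obtain ⟨⟨b, c⟩, hbc⟩ := t
      dsimp only at hbc
      obtain ⟨a, ha⟩ := hY' (hX i) i (i + 1) (i + 1 + 1) rfl rfl (X.d _ _ ≫ b) (by
        rw [Category.assoc, hbc, HomologicalComplex.d_comp_d_assoc, zero_comp])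
      exact ⟨⟨⟨a, b⟩, ha⟩, rfl⟩)
    ⟨⟨φ, φ₁⟩, hφ₁.symm⟩
  refine ⟨{ f := fun i => (s i).1.1, comm' := ?_ }, congrArg (fun t => t.1.1) hs₀⟩
  rintro i _ rfl
  rw [(s i).2, hs i]

lemma isHomExact_mappingCone {𝒞 : ObjectProperty 𝒜} {X Y : CochainComplex 𝒜 ℤ}
    (hX : IsHomExact 𝒞 X) (hY : IsHomExact 𝒞 Y) (F : X ⟶ Y) : IsHomExact 𝒞 (mappingCone F) :=
  (acyclicK 𝒞).ext_of_isTriangulatedClosed₃ _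
    (HomotopyCategory.mappingCone_triangleh_distinguished F) hX hY

lemma acyclic_mappingCone {X Y : CochainComplex 𝒜 ℤ}
    (hX : X.Acyclic) (hY : Y.Acyclic) (F : X ⟶ Y) : (mappingCone F).Acyclic := by
  rw [← HomotopyCategory.quotient_obj_mem_subcategoryAcyclic_iff_acyclic] at hX hY ⊢
  exact (HomotopyCategory.subcategoryAcyclic 𝒜).ext_of_isTriangulatedClosed₃ _
    (HomotopyCategory.mappingCone_triangleh_distinguished F) hX hY

/-- A map out of the cone is a pair `(α, β)`. Exactness for `Y` factors `β` as `d ≫ ψ`; the defect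
`F ≫ ψ - α` is then killed by the differential of `X`, and exactness for `X` factors it. -/
lemma isCohomExact_mappingCone {𝒞 : ObjectProperty 𝒜} {X Y : CochainComplex 𝒜 ℤ}
    (hX : IsCohomExact 𝒞 X) (hY : IsCohomExact 𝒞 Y) (F : X ⟶ Y) :
    IsCohomExact 𝒞 (mappingCone F) := by
  rw [isCohomExact_iff] at hX hY ⊢
  intro C hC i j k hij hjk φ hφ
  obtain ⟨α, β, rfl⟩ := mappingCone.decomp_from F φ k hjk
  have h₁ : Y.d i j ≫ β = 0 := by
    have := (mappingCone.inr F).f i ≫= hφ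
    simpa using this
  have h₂ : F.f j ≫ β = X.d j k ≫ α := by
    have := (mappingCone.inl F).v j i (by lia) ≫= hφ
    rw [mappingCone.inl_v_d_assoc F j i k (by lia) (by lia)] at this
    rw [← sub_eq_zero]
    simpa [neg_add_eq_sub] using this
  obtain ⟨ψ, rfl⟩ := hY hC i j k hij hjk β h₁
  obtain ⟨χ, hχ⟩ := hX hC j k (k + 1) hjk rfl (F.f k ≫ ψ - α) (by
    rw [Preadditive.comp_sub, ← h₂, F.comm_assoc, sub_self])
  refine ⟨(mappingCone.fst F).1.v k (k + 1) rfl ≫ χ + (mappingCone.snd F).v k k (add_zero k) ≫ ψ, ?_⟩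
  rw [Preadditive.comp_add, mappingCone.d_fst_v_assoc F j k (k + 1) hjk rfl,
    mappingCone.d_snd_v_assoc F j k hjk]
  simp only [Preadditive.neg_comp, Category.assoc, hχ, Preadditive.comp_sub, Preadditive.add_comp]
  abel

/-! ### The Gorenstein category -/

lemma prop_mappingCone_X (𝒞 : ObjectProperty 𝒜) [𝒞.IsClosedUnderFiniteProducts]
    [𝒞.IsClosedUnderIsomorphisms] {X Y : CochainComplex 𝒜 ℤ}
    (hX : ∀ i, 𝒞 (X.X i)) (hY : ∀ i, 𝒞 (Y.X i)) (F : X ⟶ Y) (i : ℤ) :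
    𝒞 ((mappingCone F).X i) := by
  refine 𝒞.prop_of_iso (?_ : X.X (i + 1) ⨯ Y.X i ≅ _) (𝒞.prop_prod _ _ (hX _) (hY _))
  exact
    { hom := prod.fst ≫ (mappingCone.inl F).v (i + 1) i (by lia) +
        prod.snd ≫ (mappingCone.inr F).f i
      inv := prod.lift ((mappingCone.fst F).1.v i (i + 1) rfl)
        ((mappingCone.snd F).v i i (add_zero i))
      hom_inv_id := by ext <;> simp
      inv_hom_id := by
        rw [Preadditive.comp_add, prod.lift_fst_assoc, prod.lift_snd_assoc, mappingCone.id_X] }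

/-- The Gorenstein category described by epi-mono factorizations of differentials. -/
lemma gorenstein_iff (𝒞 : ObjectProperty 𝒜) (M : 𝒜) :
    gorenstein 𝒞 M ↔ ∃ (X : CochainComplex 𝒜 ℤ) (p : X.X (-1) ⟶ M) (ι : M ⟶ X.X 0),
      (∀ i, 𝒞 (X.X i)) ∧ X.Acyclic ∧ IsHomExact 𝒞 X ∧ IsCohomExact 𝒞 X ∧
        Epi p ∧ Mono ι ∧ p ≫ ι = X.d (-1) 0 := by
  constructor
  · rintro ⟨X, h₁, h₂, h₃, h₄, ⟨e⟩⟩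
    exact ⟨X, factorThruImage (X.d (-1) 0) ≫ e.inv, e.hom ≫ image.ι _, h₁, h₂, h₃, h₄,
      epi_comp _ _, mono_comp _ _, by simp⟩
  · rintro ⟨X, p, ι, h₁, h₂, h₃, h₄, _, _, h₅⟩
    have := strongEpi_of_epi p
    refine ⟨X, h₁, h₂, h₃, h₄, ⟨image.isoStrongEpiMono p ι h₅⟩⟩

instance (𝒞 : ObjectProperty 𝒜) : (gorenstein 𝒞).IsClosedUnderIsomorphisms where
  of_iso e h := by
    obtain ⟨X, h₁, h₂, h₃, h₄, ⟨e'⟩⟩ := h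
    exact ⟨X, h₁, h₂, h₃, h₄, ⟨e.symm ≪≫ e'⟩⟩

open scoped ZeroObject in
instance (𝒞 : ObjectProperty 𝒜) [𝒞.IsClosedUnderFiniteProducts]
    [𝒞.IsClosedUnderIsomorphisms] : (gorenstein 𝒞).ContainsZero where
  exists_zero := by
    have h (i : ℤ) : IsZero ((0 : CochainComplex 𝒜 ℤ).X i) :=
      (HomologicalComplex.eval 𝒜 (ComplexShape.up ℤ) i).map_isZero (isZero_zero _)
    refine ⟨0, isZero_zero 𝒜, (gorenstein_iff _ _).2 ⟨0, 0, 0, fun i => 𝒞.prop_of_isZero (h i),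
      fun i => ?_, (isHomExact_iff _ _).2 ?_, (isCohomExact_iff _ _).2 ?_, (isZero_zero 𝒜).epi _,
      (isZero_zero 𝒜).mono _, (h _).eq_of_src _ _⟩⟩
    · exact ShortComplex.exact_of_isZero_X₂ _ (h i)
    · exact fun _ _ i j k _ _ φ _ => ⟨0, (h j).eq_of_tgt _ _⟩
    · exact fun _ _ i j k _ _ φ _ => ⟨0, (h j).eq_of_src _ _⟩

/-- By acyclicity `M`, the image of the differential into degree 0, is also the kernel of the next
one. -/
lemma exists_comp_eq_of_acyclic {X : CochainComplex 𝒜 ℤ} (hX : X.Acyclic) {M : 𝒜}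
    (p : X.X (-1) ⟶ M) (ι : M ⟶ X.X 0) [Epi p] [Mono ι] (h : p ≫ ι = X.d (-1) 0)
    {T : 𝒜} (c : T ⟶ X.X 0) (hc : c ≫ X.d 0 1 = 0) : ∃ l, l ≫ ι = c := by
  have hι : ι ≫ X.d 0 1 = 0 := by
    rw [← cancel_epi p, reassoc_of% h, HomologicalComplex.d_comp_d, comp_zero]
  have hS : (ShortComplex.mk ι (X.d 0 1) hι).Exact := by
    have := hX 0
    rw [X.exactAt_iff' (-1) 0 1 (by simp) (by simp)] at this
    let φ : X.sc' (-1) 0 1 ⟶ ShortComplex.mk ι (X.d 0 1) hι :=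
      { τ₁ := p, τ₂ := 𝟙 _, τ₃ := 𝟙 _
        comm₁₂ := by
          change p ≫ ι = X.d (-1) 0 ≫ 𝟙 _
          rw [h, Category.comp_id]
        comm₂₃ := (Category.id_comp _).trans (Category.comp_id _).symm }
    have : Epi φ.τ₁ := inferInstanceAs (Epi p)
    have : IsIso φ.τ₂ := inferInstanceAs (IsIso (𝟙 _))
    have : Mono φ.τ₃ := inferInstanceAs (Mono (𝟙 _))
    rwa [← ShortComplex.exact_iff_of_epi_of_isIso_of_mono φ]
  have : Mono (ShortComplex.mk ι (X.d 0 1) hι).f := ‹Mono ι›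
  exact ⟨hS.lift c hc, hS.lift_f c hc⟩

/-- An object `G` of the Gorenstein category embeds in an object `C` of `𝒞` such that
the pushout of the embedding along any morphism from `G` to an object of the Gorenstein category
is in the Gorenstein category. -/
lemma gorenstein.exists_embedding {𝒞 : ObjectProperty 𝒜} [𝒞.IsClosedUnderFiniteProducts]
    [𝒞.IsClosedUnderIsomorphisms] {G : 𝒜} (hG : gorenstein 𝒞 G) :
    ∃ (C : 𝒜) (j : G ⟶ C), 𝒞 C ∧ Mono j ∧ ∀ ⦃G' : 𝒜⦄, gorenstein 𝒞 G' → ∀ f : G ⟶ G',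
      gorenstein 𝒞 (cokernel (biprod.lift f j)) ∧ ∀ ⦃C' : 𝒜⦄, 𝒞 C' →
        ∀ y : C' ⟶ cokernel (biprod.lift f j), ∃ t, t ≫ cokernel.π (biprod.lift f j) = y := by
  obtain ⟨X, p, ι, hX, hXa, hXh, hXc, _, _, hp⟩ := (gorenstein_iff _ _).1 hG
  refine ⟨X.X 0, ι, hX 0, inferInstance, fun G' hG' f => ?_⟩
  obtain ⟨Y, p', ι', hY, hYa, hYh, hYc, _, _, hp'⟩ := (gorenstein_iff _ _).1 hG'
  have hdp : X.d (-2) (-1) ≫ p = 0 := by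
    rw [← cancel_mono ι, Category.assoc, hp, HomologicalComplex.d_comp_d, zero_comp]
  have hιd : ι ≫ X.d 0 1 = 0 := by
    rw [← cancel_epi p, reassoc_of% hp, HomologicalComplex.d_comp_d, comp_zero]
  have hιd' : ι' ≫ Y.d 0 1 = 0 := by
    rw [← cancel_epi p', reassoc_of% hp', HomologicalComplex.d_comp_d, comp_zero]
  -- The chain map extends `-f` rather than `f`, so that `q`, sending `(g, c)` to `ι' g + F c - d
  -- c`, has kernel exactly `biprod.lift f ι`.
  obtain ⟨φ, hφ⟩ := (isCohomExact_iff _ _).1 hXc (hY 0) (-2) (-1) 0 rfl rfl (p ≫ (-f) ≫ ι')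
    (by rw [reassoc_of% hdp, zero_comp])
  obtain ⟨F, rfl⟩ := exists_hom_f_zero_eq hX hY hXc hYh φ
    (by rw [reassoc_of% hφ, hιd', comp_zero, comp_zero])
  have hF : ι ≫ F.f 0 = -f ≫ ι' := by
    rw [← cancel_epi p, reassoc_of% hp, hφ, Preadditive.neg_comp]
  let W := mappingCone F
  have hWh : IsHomExact 𝒞 W := isHomExact_mappingCone hXh hYh F
  let q : G' ⊞ X.X 0 ⟶ W.X 0 := biprod.desc (ι' ≫ (mappingCone.inr F).f 0)
    ((mappingCone.inl F).v 0 (-1) (by lia) ≫ W.d (-1) 0)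
  have hd : (mappingCone.inl F).v 0 (-1) (by lia) ≫ W.d (-1) 0 =
      F.f 0 ≫ (mappingCone.inr F).f 0 - X.d 0 1 ≫ (mappingCone.inl F).v 1 0 (by lia) :=
    mappingCone.inl_v_d F 0 (-1) 1 (by lia) (by lia)
  have hq : biprod.lift f ι ≫ q = 0 := by
    simp only [q, biprod.lift_desc, hd, Preadditive.comp_sub, reassoc_of% hF, reassoc_of% hιd,
      zero_comp, sub_zero, Preadditive.neg_comp, Category.assoc, add_neg_cancel]
  have : Mono (biprod.lift f ι) := mono_of_mono_fac (biprod.lift_snd f ι)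
  have hker {A : 𝒜} (k : A ⟶ G' ⊞ X.X 0) (hk : k ≫ q = 0) :
      ∃ l, l ≫ biprod.lift f ι = k := by
    have hk' : k = biprod.lift (k ≫ biprod.fst) (k ≫ biprod.snd) := by ext <;> simp
    generalize k ≫ biprod.fst = g at hk'
    generalize k ≫ biprod.snd = c at hk'
    subst hk'
    rw [biprod.lift_desc, hd] at hk
    have h₁ : c ≫ X.d 0 1 = 0 := by
      simpa using hk =≫ (mappingCone.fst F).1.v 0 1 rfl
    have h₂ : g ≫ ι' + c ≫ F.f 0 = 0 := by
      simpa using hk =≫ (mappingCone.snd F).v 0 0 rfl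
    obtain ⟨l, rfl⟩ := exists_comp_eq_of_acyclic hXa p ι hp c h₁
    refine ⟨l, ?_⟩
    ext
    · rw [Category.assoc, biprod.lift_fst, biprod.lift_fst, ← cancel_mono ι', Category.assoc]
      rw [Category.assoc, hF, Preadditive.comp_neg, ← sub_eq_add_neg, sub_eq_zero] at h₂
      exact h₂.symm
    · simp
  have hS : (ShortComplex.mk _ _ hq).Exact := by
    refine ShortComplex.exact_of_f_is_kernel _ (KernelFork.IsLimit.ofι' _ _ fun k hk => ?_)
    exact ⟨(hker k hk).choose, (hker k hk).choose_spec⟩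
  let m : cokernel (biprod.lift f ι) ⟶ W.X 0 := cokernel.desc _ q hq
  have : Mono m := hS.mono_cokernelDesc
  -- `W.X (-1)` is `X.X 0 ⊕ Y.X (-1)`, and `p'` maps the second summand onto `G'`. Thus `r ≫ q` is
  -- the differential of `W`, whose image is the cokernel sought.
  let r : W.X (-1) ⟶ G' ⊞ X.X 0 := biprod.lift ((mappingCone.snd F).v (-1) (-1) (add_zero _) ≫ p')
    ((mappingCone.fst F).1.v (-1) 0 rfl)
  have hr₁ : (mappingCone.inl F).v 0 (-1) (by lia) ≫ r = biprod.inr := by ext <;> simp [r]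
  have hr₂ : (mappingCone.inr F).f (-1) ≫ r = p' ≫ biprod.inl := by ext <;> simp [r]
  have : Epi r := ⟨fun a b hab => by
    ext
    · rw [← cancel_epi p', ← reassoc_of% hr₂, ← reassoc_of% hr₂, hab]
    · rw [← reassoc_of% hr₁, ← reassoc_of% hr₁, hab]⟩
  have hrq : r ≫ q = W.d (-1) 0 := by
    refine mappingCone.ext_from F 0 (-1) rfl ?_ ?_
    · rw [reassoc_of% hr₁, biprod.inr_desc]
    · rw [reassoc_of% hr₂, biprod.inl_desc, reassoc_of% hp', mappingCone.inr_f_d]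
  have hrm : (r ≫ cokernel.π (biprod.lift f ι)) ≫ m = W.d (-1) 0 := by
    rw [Category.assoc, cokernel.π_desc, hrq]
  refine ⟨(gorenstein_iff _ _).2 ⟨W, r ≫ cokernel.π _, m, prop_mappingCone_X 𝒞 hX hY F,
    acyclic_mappingCone hXa hYa F, hWh, isCohomExact_mappingCone hXc hYc F, epi_comp _ _,
    inferInstance, hrm⟩, fun C' hC' y => ?_⟩
  -- Through `m`, the map `y` becomes a cocycle of `W` in degree 0; it lifts to `W.X (-1)`, and `r`
  -- carries the lift to `G' ⊞ X.X 0`.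
  obtain ⟨z, hz⟩ := (isHomExact_iff _ _).1 hWh hC' (-1) 0 1 rfl rfl (y ≫ m) (by
    have hm : m ≫ W.d 0 1 = 0 := by
      rw [← cancel_epi (r ≫ cokernel.π (biprod.lift f ι)), ← Category.assoc, hrm,
        HomologicalComplex.d_comp_d, comp_zero]
    rw [Category.assoc, hm, comp_zero])
  refine ⟨z ≫ r, ?_⟩
  rw [← cancel_mono m, Category.assoc, Category.assoc, ← hz, ← hrm, Category.assoc]

/-! ### Shortening a complex of Gorenstein objects at the bottom -/

/-- The canonical isomorphism from the terms of a mapping cocone. -/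
def mappingCoconeXIso {K L : CochainComplex 𝒜 ℤ} (g : K ⟶ L) (i j : ℤ) (hij : i + 1 = j) :
    (mappingCocone g).X j ≅ K.X j ⊞ L.X i where
  hom := biprod.lift ((mappingCocone.fst g).f j) ((mappingCocone.snd g).v j i (by lia))
  inv := biprod.desc ((mappingCocone.inl g).v j j (add_zero j))
    ((mappingCocone.inr g).1.v i j (by lia))
  hom_inv_id := by rw [biprod.lift_desc, mappingCocone.id_X]
  inv_hom_id := by ext <;> simp

lemma mappingCocone_d_snd_v {K L : CochainComplex 𝒜 ℤ} (g : K ⟶ L) (i j k : ℤ)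
    (hij : j + -1 = i) (hk : i + -1 = k) :
    (mappingCocone g).d i j ≫ (mappingCocone.snd g).v j i hij =
      -(mappingCocone.fst g).f i ≫ g.f i - (mappingCocone.snd g).v i k hk ≫ L.d k i := by
  subst hij hk
  have h₁ (l : ℤ) : (mappingCocone.snd g).v l (l + -1) rfl =
      (mappingCone.snd g).v (l + -1) (l + -1) (add_zero _) := by
    refine (HomComplex.Cochain.leftShift_v (mappingCone.snd g) (-1) (-1) (zero_add _) l (l + -1) rfl
      (l + -1) (add_zero _)).trans ?_
    rw [Int.negOnePow_even _ (by decide), one_smul]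
    exact Category.id_comp _
  have h₂ (l : ℤ) : (mappingCocone.fst g).f l = (mappingCone.fst g).1.v (l + -1) l (by lia) := by
    simp only [mappingCocone.fst, HomologicalComplex.neg_f_apply, HomComplex.Cocycle.homOf_f,
      HomComplex.Cocycle.leftShift_coe]
    refine (congrArg _ (HomComplex.Cochain.leftShift_v (mappingCone.fst g).1 (-1) 0 (by lia) l l
      (add_zero l) (l + -1) (by lia))).trans ?_
    rw [Int.negOnePow_odd _ (by decide), Units.neg_smul, one_smul]
    exact (neg_neg _).trans (Category.id_comp _)
  have h₃ : (mappingCocone g).d (j + -1) j = - (mappingCone g).d (j + -1 + -1) (j + -1) := by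
    simp [mappingCocone]
  rw [h₁, h₁, h₂, h₃]
  have := mappingCone.d_snd_v g (j + -1 + -1) (j + -1) (by lia)
  exact ((Preadditive.neg_comp _ _).trans (congrArg Neg.neg this)).trans <|
    (neg_add _ _).trans (sub_eq_add_neg _ _).symm

/-- A complex of Gorenstein objects in degrees `[a, b]` is isomorphic in the singularity category
to such a complex in degrees `[a + 1, b]`. -/
lemma exists_sgIso_isStrictlyGE_add_one (𝒞 : ObjectProperty 𝒜) [𝒞.IsClosedUnderFiniteProducts]
    [𝒞.IsClosedUnderIsomorphisms] (X : CochainComplex 𝒜 ℤ) (hX : ∀ i, gorenstein 𝒞 (X.X i))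
    (a b : ℤ) (hab : a < b) [X.IsStrictlyGE a] [X.IsStrictlyLE b] :
    ∃ Y : CochainComplex 𝒜 ℤ, Y.IsStrictlyGE (a + 1) ∧ Y.IsStrictlyLE b ∧
      (∀ i, gorenstein 𝒞 (Y.X i)) ∧ SgIso 𝒞 X Y := by
  obtain ⟨C, j, hC, _, hj⟩ := (hX a).exists_embedding
  let S : CochainComplex 𝒜 ℤ := (HomologicalComplex.single 𝒜 (ComplexShape.up ℤ) a).obj C
  let g : X ⟶ S := HomologicalComplex.mkHomToSingle j (fun i (hi : i + 1 = a) =>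
    (X.isZero_of_isStrictlyGE a i (by lia)).eq_of_src _ _)
  have hg : g.f a = j ≫ (HomologicalComplex.singleObjXSelf _ a C).inv :=
    HomologicalComplex.mkHomToSingle_f _ _
  have hS (i : ℤ) (hi : i ≠ a) : IsZero (S.X i) := HomologicalComplex.isZero_single_obj_X _ _ _ _ hi
  have hXb : IsBoundedComplex X := .mk X a b
  have hSb : IsBoundedComplex S := .mk S a a
  -- The cocone differs from `X` only in degree `a + 1`, where it is `X^{a+1} ⊕ C`. As `a < b`, the
  -- upper bound `b` is kept.
  let W := mappingCocone g
  have hWX (i : ℤ) (hi : i ≠ a + 1) : IsIso ((mappingCocone.fst g).f i) := by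
    refine ⟨(mappingCocone.inl g).v i i (add_zero i), ?_, by simp⟩
    have := mappingCocone.id_X g i (i - 1) (by lia)
    rwa [(hS (i - 1) (by lia)).eq_of_tgt ((mappingCocone.snd g).v i (i - 1) (by lia)) 0, zero_comp,
      add_zero] at this
  have hWGE : W.IsStrictlyGE a := by
    rw [isStrictlyGE_iff]
    intro i hi
    have := hWX i (by lia)
    exact (X.isZero_of_isStrictlyGE a i hi).of_iso (asIso ((mappingCocone.fst g).f i))
  have hWLE : W.IsStrictlyLE b := by
    rw [isStrictlyLE_iff]
    intro i hi
    have := hWX i (by lia)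
    exact (X.isZero_of_isStrictlyLE b i hi).of_iso (asIso ((mappingCocone.fst g).f i))
  have := hWX a (by lia)
  let α : W.X a ≅ X.X a := asIso ((mappingCocone.fst g).f a)
  obtain ⟨f, β, hβ⟩ : ∃ (f : X.X a ⟶ X.X (a + 1)) (β : W.X (a + 1) ≅ X.X (a + 1) ⊞ C),
      W.d a (a + 1) ≫ β.hom = α.hom ≫ biprod.lift f j := by
    -- The identification of the summand `C` is negated to absorb the sign in
    -- `mappingCocone_d_snd_v`.
    refine ⟨X.d a (a + 1), mappingCoconeXIso g a (a + 1) rfl ≪≫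
      biprod.mapIso (Iso.refl _) (-HomologicalComplex.singleObjXSelf _ a C), ?_⟩
    ext
    · simp [α, W, mappingCoconeXIso]
    · have := mappingCocone_d_snd_v g a (a + 1) (a - 1) (by lia) (by lia)
      have hd : S.d (a - 1) a = 0 := HomologicalComplex.single_obj_d _ _ _ _ _
      simp [α, W, mappingCoconeXIso, reassoc_of% this, hg, hd]
  obtain ⟨hG, hlift⟩ := hj (hX (a + 1)) f
  have : Mono (biprod.lift f j) := mono_of_mono_fac (biprod.lift_snd f j)
  have hWmono : Mono (W.d a (a + 1)) := by
    have : Mono (W.d a (a + 1) ≫ β.hom) := by rw [hβ]; infer_instance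
    exact mono_of_mono _ β.hom
  let T := W.truncGE (a + 1)
  let γ : T.X (a + 1) ≅ cokernel (biprod.lift f j) := W.truncGEXIsoOpcycles (a + 1) ≪≫
    (W.opcyclesIsCokernel a (a + 1) (by simp)).coconePointUniqueUpToIso
      (cokernelIsCokernel (W.d a (a + 1))) ≪≫ cokernel.mapIso _ _ α β hβ
  have hγ : (W.πTruncGE (a + 1)).f (a + 1) ≫ γ.hom = β.hom ≫ cokernel.π (biprod.lift f j) := by
    have h : W.pOpcycles (a + 1) ≫ ((W.opcyclesIsCokernel a (a + 1)
        (by simp)).coconePointUniqueUpToIso (cokernelIsCokernel (W.d a (a + 1)))).hom =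
          cokernel.π (W.d a (a + 1)) :=
      IsColimit.comp_coconePointUniqueUpToIso_hom (W.opcyclesIsCokernel a (a + 1) (by simp))
        (cokernelIsCokernel (W.d a (a + 1))) WalkingParallelPair.one
    simp only [γ, πTruncGE_f_self, Iso.trans_hom, Category.assoc, Iso.inv_hom_id_assoc,
      reassoc_of% h, cokernel.mapIso_hom, cokernel.π_desc]
  refine ⟨T, inferInstance, inferInstance, fun i => ?_,
    (SgIso.fst_of_terms 𝒞 hXb hSb g (prop_single_X 𝒞 hC _)).symm.trans
    (SgIso.of_isHomExact 𝒞 (.mk W a b) (.mk T (a + 1) b) (W.πTruncGE (a + 1))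
      (isHomExact_mappingCone_of_surjective 𝒞 _ ?_ ?_))⟩
  · obtain hi | rfl | hi := lt_trichotomy i (a + 1)
    · exact (gorenstein 𝒞).prop_of_isZero (T.isZero_of_isStrictlyGE (a + 1) i hi)
    · exact (gorenstein 𝒞).prop_of_iso γ.symm hG
    · have := hWX i hi.ne'
      exact (gorenstein 𝒞).prop_of_iso ((W.truncGEXIso (a + 1) i hi).trans
        (asIso ((mappingCocone.fst g).f i))).symm (hX i)
  · intro C' hC' i y
    obtain hi | rfl | hi := lt_trichotomy i (a + 1)
    · exact ⟨0, (T.isZero_of_isStrictlyGE (a + 1) i hi).eq_of_tgt _ _⟩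
    · obtain ⟨t, ht⟩ := hlift hC' (y ≫ γ.hom)
      refine ⟨t ≫ β.inv, ?_⟩
      rw [← cancel_mono γ.hom, Category.assoc, Category.assoc, hγ, Iso.inv_hom_id_assoc, ht]
    · have := isIso_πTruncGE_f W (a + 1) i hi
      exact ⟨y ≫ inv ((W.πTruncGE (a + 1)).f i), by simp⟩
  · intro C' hC' i k l hik hkl x hx hx'
    obtain hk | rfl | hk := lt_trichotomy k (a + 1)
    · obtain rfl : x = 0 := by
        obtain hk | rfl := (show k ≤ a by lia).lt_or_eq
        · exact (W.isZero_of_isStrictlyGE a k hk).eq_of_tgt _ _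
        · subst hkl
          rwa [← cancel_mono (W.d k (k + 1)), zero_comp]
      exact ⟨0, by simp, by simp⟩
    -- The kernel of the projection in degree `a + 1` is the image of the monomorphism `W.d a (a +
    -- 1)`, so `x` lifts to `W.X a`, where the truncation vanishes.
    · obtain rfl : i = a := by lia
      have hS : (ShortComplex.mk (W.d i (i + 1)) (W.pOpcycles (i + 1)) (by simp)).Exact :=
        ShortComplex.exact_of_g_is_cokernel _ (W.opcyclesIsCokernel i (i + 1) (by simp))
      have : Mono (ShortComplex.mk (W.d i (i + 1)) (W.pOpcycles (i + 1)) (by simp)).f := hWmono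
      have hx'' : x ≫ W.pOpcycles (i + 1) = 0 := by
        rwa [πTruncGE_f_self, ← Category.assoc, Preadditive.IsIso.comp_right_eq_zero] at hx'
      exact ⟨hS.lift x hx'', hS.lift_f x hx'',
        (T.isZero_of_isStrictlyGE (i + 1) i (by lia)).eq_of_tgt _ _⟩
    · have := isIso_πTruncGE_f W (a + 1) k hk
      rw [Preadditive.IsIso.comp_right_eq_zero] at hx'
      subst hx'
      exact ⟨0, by simp, by simp⟩

/-- A complex of Gorenstein objects in degrees `[-n, 0]` is isomorphic in the singularity category
to a Gorenstein object in degree `0`. -/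
lemma exists_sgIso_single_gorenstein (𝒞 : ObjectProperty 𝒜) [𝒞.IsClosedUnderFiniteProducts]
    [𝒞.IsClosedUnderIsomorphisms] (n : ℕ) (X : CochainComplex 𝒜 ℤ)
    (hX : ∀ i, gorenstein 𝒞 (X.X i)) [X.IsStrictlyGE (-n)] [X.IsStrictlyLE 0] :
    ∃ G, gorenstein 𝒞 G ∧ SgIso 𝒞 X ((singleFunctor 𝒜 0).obj G) := by
  induction n generalizing X with
  | zero =>
    have : X.IsStrictlyGE 0 := X.isStrictlyGE_of_ge 0 (-(0 : ℕ)) (by simp)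
    obtain ⟨G, ⟨e⟩⟩ := X.exists_iso_single 0
    refine ⟨G, ?_, .of_iso 𝒞 (.mk X 0 0) e⟩
    let e₀ : X.X 0 ≅ ((HomologicalComplex.single 𝒜 (ComplexShape.up ℤ) 0).obj G).X 0 :=
      (HomologicalComplex.eval 𝒜 (ComplexShape.up ℤ) 0).mapIso e
    exact (gorenstein 𝒞).prop_of_iso (e₀ ≪≫ HomologicalComplex.singleObjXSelf _ 0 G) (hX 0)
  | succ n ih =>
    obtain ⟨Y, _, _, hY, h⟩ := exists_sgIso_isStrictlyGE_add_one 𝒞 X hX (-(n + 1 : ℕ)) 0 (by lia)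
    have : Y.IsStrictlyGE (-n) := Y.isStrictlyGE_of_ge _ (-(n + 1 : ℕ) + 1) (by lia)
    obtain ⟨G, hG, h'⟩ := ih Y hY
    exact ⟨G, hG, h.trans h'⟩

/-- Every bounded complex is isomorphic in the singularity category to a Gorenstein object if every
object has a finite proper resolution by Gorenstein objects. -/
lemma exists_gorenstein_sgIso (𝒞 : ObjectProperty 𝒜) [𝒞.IsClosedUnderFiniteProducts]
    [𝒞.IsClosedUnderIsomorphisms] (hC : IsContravariantlyFinite 𝒞)
    (hdim : ∀ M : 𝒜, ∃ n, HasProperResolution 𝒞 (gorenstein 𝒞) M n)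
    (X : CochainComplex 𝒜 ℤ) (hX : IsBoundedComplex X) :
    ∃ G, gorenstein 𝒞 G ∧ SgIso 𝒞 X ((singleFunctor 𝒜 0).obj G) := by
  obtain ⟨a, b, _, _⟩ := hX
  -- Concentrating in a degree `-c ≤ 0` keeps the resolution in degrees at most 0, so the shortening
  -- from below can end exactly in degree 0.
  obtain ⟨c, hc⟩ : ∃ c : ℕ, -(c : ℤ) ≤ a := ⟨(-a).toNat, by lia⟩
  have : X.IsStrictlyGE (-c) := X.isStrictlyGE_of_ge _ a hc
  have : X.IsStrictlyLE (-c + (b + c).toNat) := X.isStrictlyLE_of_le b _ (by lia)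
  obtain ⟨Y, _, _, hY⟩ := exists_sgIso_concentrated 𝒞 hC X (-c) (b + c).toNat
  obtain ⟨M, ⟨e⟩⟩ := Y.exists_iso_single (-c)
  obtain ⟨n, hn⟩ := hdim M
  obtain ⟨R, _, _, hR, h⟩ := exists_sgIso_of_hasProperResolution 𝒞 _ hn (-c)
  have : R.IsStrictlyGE (-(c + n : ℕ)) := R.isStrictlyGE_of_ge _ (-c - n) (by lia)
  have : R.IsStrictlyLE 0 := R.isStrictlyLE_of_le (-c) _ (by lia)
  obtain ⟨G, hG, h'⟩ := exists_sgIso_single_gorenstein 𝒞 (c + n) R hR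
  exact ⟨G, hG, ((hY.trans (.of_iso 𝒞 (.mk Y (-c) (-c)) e)).trans h.symm).trans h'⟩

/-- In `ℕ∞` an infimum over an empty family is `⊤`, so an object without a finite resolution would
make the supremum infinite. -/
lemma exists_hasProperResolution (𝒞 𝒟 : ObjectProperty 𝒜) (h : properDimOf 𝒞 𝒟 ⊤ < ⊤) (M : 𝒜) :
    ∃ n, HasProperResolution 𝒞 𝒟 M n := by
  by_contra! hM
  have h₁ : properDim 𝒞 𝒟 M ≤ properDimOf 𝒞 𝒟 ⊤ :=
    le_iSup₂_of_le (f := fun M (_ : (⊤ : ObjectProperty 𝒜) M) => properDim 𝒞 𝒟 M) M trivial le_rfl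
  have h₂ : properDim 𝒞 𝒟 M = ⊤ := by simp [properDim, hM]
  rw [h₂] at h₁
  exact (h₁.trans_lt h).ne rfl

theorem theta_essSurj (𝒞 : ObjectProperty 𝒜) [𝒞.IsClosedUnderFiniteProducts]
    [𝒞.IsClosedUnderIsomorphisms] (hC : IsContravariantlyFinite 𝒞)
    (hdim : properDimOf 𝒞 (gorenstein 𝒞) ⊤ < ⊤) : (theta 𝒞).EssSurj where
  mem_essImage Z := by
    let X : Kb 𝒜 := (Qb 𝒞).objPreimage ((Qsg 𝒞).objPreimage Z)
    obtain ⟨G, hG, _, _, ⟨e⟩⟩ := exists_gorenstein_sgIso 𝒞 hC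
      (exists_hasProperResolution 𝒞 _ hdim) X.obj.as X.property
    exact ⟨⟨G, hG⟩, ⟨e.symm ≪≫ (Qsg 𝒞).mapIso ((Qb 𝒞).objObjPreimageIso _) ≪≫
      (Qsg 𝒞).objObjPreimageIso Z⟩⟩

end RelSing

end

/-- Let `A` be a finite-dimensional algebra over a field, let `𝒜` be the category of finitely
generated left `A`-modules, and let `𝒞` be a full additive subcategory of `𝒜` which is admissible
(in particular contravariantly finite) and closed under direct summands. If the `𝒞`-proper
`𝒢(𝒞)`-dimension of `𝒜` is finite, then `θ : 𝒢(𝒞) ⥤ D_{𝒞-sg}(𝒜)` is essentially surjective. -/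
theorem theorem4p11 {k : Type v} [Field k] {A : Type u} [Ring A] [Algebra k A] [Module.Finite k A]
    (𝒞 : ObjectProperty (FGModuleCat.{u} A))
    [𝒞.IsClosedUnderFiniteProducts] [𝒞.IsStableUnderRetracts]
    (hadm : RelSing.IsAdmissible 𝒞) :
    haveI : IsNoetherianRing A := IsNoetherianRing.of_finite k A
    RelSing.properDimOf 𝒞 (RelSing.gorenstein 𝒞) ⊤ < ⊤ → (RelSing.theta 𝒞).EssSurj := by
  intro hdim
  have : IsNoetherianRing A := IsNoetherianRing.of_finite k A
  exact RelSing.theta_essSurj 𝒞 hadm.1 hdim
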